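/- Let $H$ be a probability distribution on $\mathbb{R}^2$ with continuous marginal distribution functions, and let $(X_1,Y_1),\dots,(X_n,Y_n)$ be an i.i.d. sample from $H$. Let $R_i=\#\{j: X_j\le X_i\}$ and $S_i=\#\{j: Y_j\le Y_i\}$ be the ranks, and for $(u,v)\in(0,1)^2$ let \[ C_n(u,v)=\frac1n\sum_{i=1}^n \mathbf 1\Big(\frac{R_i}{n}\le u,\ \frac{S_i}{n}\le v\Big) \] be the plug-in copula estimator. Let $\Phi$ be the distribution function of $N(0,1)$. Assume the null hypothesis of independence $H_0$: $H$ is the product of its two marginals. Then for every $(u,v)\in(0,1)^2$ and every $d>0$ there are constants $A_1,A_2>0$, depending only on $u,v,d$ (in particular not on $x$, on $n$ or on the marginals of $H$), such that for every real $x\neq 0$ and every sufficiently large $n$, namely every $n\in\mathbb{N}$ with $n\ge x^{-4}$ (equivalently $|x|\ge n^{-1/4}$, $n\ge 1$), \[ \left|P\big(C_n(u,v)-uv\le x\big)-\Phi\Big(\sqrt{\tfrac{n}{d}}\,x\Big)\right|\le A_1\sqrt n\,x^2\exp\left(-A_2\,n\,x^2\right). \] -/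

import Mathlib

open MeasureTheory ProbabilityTheory

/-- The rank of `a i` among `a 0, …, a (n-1)`: the number of entries that do not exceed `a i`.
If there are no ties, this is the usual rank in `{1, …, n}`. -/
noncomputable def sampleRank {n : ℕ} (a : Fin n → ℝ) (i : Fin n) : ℕ := by
  classical
  exact (Finset.univ.filter fun j => a j ≤ a i).card

/-- The rank-based plug-in copula estimator
`C_n(u,v) = (1/n) ∑ i, 1(R_i / n ≤ u, S_i / n ≤ v)` of the data `(x_i, y_i)`,
where `R_i`, `S_i` are the ranks of `x_i`, `y_i`. -/
noncomputable def empiricalCopula {n : ℕ} (x y : Fin n → ℝ) (u v : ℝ) : ℝ := by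
  classical
  exact (1 / (n : ℝ)) * ∑ i : Fin n,
    if (sampleRank x i : ℝ) / n ≤ u ∧ (sampleRank y i : ℝ) / n ≤ v then (1 : ℝ) else 0

/-- `(X_1, Y_1), …, (X_n, Y_n)` is an i.i.d. sample, on the probability space `(Ω, P)`,
from the joint distribution `H` on the plane. -/
structure IsIIDSample {Ω : Type*} [MeasurableSpace Ω] (P : Measure Ω) (H : Measure (ℝ × ℝ))
    {n : ℕ} (X Y : Fin n → Ω → ℝ) : Prop where
  measurable_fst : ∀ i, Measurable (X i)
  measurable_snd : ∀ i, Measurable (Y i)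
  law : ∀ i, P.map (fun ω => (X i ω, Y i ω)) = H
  indep : iIndepFun (fun i ω => (X i ω, Y i ω)) P

/-- Both marginal distribution functions of `H` are continuous. -/
def HasContinuousMarginals (H : Measure (ℝ × ℝ)) : Prop :=
  Continuous (cdf H.fst) ∧ Continuous (cdf H.snd)

/-- The null hypothesis of independence: `H` is the product of its marginals. -/
def NullHypothesis (H : Measure (ℝ × ℝ)) : Prop :=
  H = H.fst.prod H.snd

/-- The distribution function `Φ` of the standard normal law. -/
noncomputable def stdNormalCDF (x : ℝ) : ℝ := cdf (gaussianReal 0 1) x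

/-! No central limit theorem is involved. When `n x⁴ ≥ 1` the factor `√n x²` is at least `1`
(`one_le_sqrt_mul_sq`), so it suffices that the probability and `Φ` are both exponentially close to
`0` (if `x < 0`) or to `1` (if `x > 0`); hence any `d > 0` works. For `Φ` this is the Chernoff
bound. For the copula, ranks are replaced by fixed quantiles at levels shifted by `δ`: outside three
Hoeffding events, two for the marginal counts and one for the count in a quadrant, the rank
condition is sandwiched by a quadrant condition, whose probability factorizes under independence. -/

/-- The number of entries of `z` that lie in `A`, as a real number. -/
noncomputable def countIn {α : Type*} {n : ℕ} (A : Set α) (z : Fin n → α) : ℝ :=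
  ∑ i, A.indicator (fun _ => (1 : ℝ)) (z i)

lemma countIn_add_countIn_compl {α : Type*} {n : ℕ} (A : Set α) (z : Fin n → α) :
    countIn A z + countIn Aᶜ z = n := by
  classical
  simp only [countIn, ← Finset.sum_add_distrib, Set.indicator_self_add_compl_apply]
  simp

/-- Hoeffding's upper tail bound for the number of sample points in a measurable set. -/
lemma measureReal_le_countIn_le {Ω α : Type*} [MeasurableSpace Ω] [MeasurableSpace α]
    {P : Measure Ω} [IsProbabilityMeasure P] {H : Measure α} [IsProbabilityMeasure H] {n : ℕ}
    {Z : Fin n → Ω → α} (hZ : ∀ i, Measurable (Z i)) (hlaw : ∀ i, P.map (Z i) = H)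
    (hind : iIndepFun Z P) {A : Set α} (hA : MeasurableSet A) {ε : ℝ} (hε : 0 ≤ ε) :
    P.real {ω | (n : ℝ) * (H.real A + ε) ≤ countIn A (fun i => Z i ω)}
      ≤ Real.exp (-2 * n * ε ^ 2) := by
  rcases Nat.eq_zero_or_pos n with rfl | hn
  · simp
  have hf : Measurable (A.indicator fun _ => (1 : ℝ)) := measurable_const.indicator hA
  have hmean : ∀ i, ∫ ω, A.indicator (fun _ => (1 : ℝ)) (Z i ω) ∂P = H.real A := fun i => by
    rw [← integral_map (hZ i).aemeasurable hf.aestronglyMeasurable, hlaw i,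
      integral_indicator_const _ hA]
    simp
  have hsub : ∀ i ∈ Finset.univ, HasSubgaussianMGF
      (fun ω => A.indicator (fun _ => (1 : ℝ)) (Z i ω) - H.real A) ((‖(1 : ℝ) - 0‖₊ / 2) ^ 2) P :=
    fun i _ => by
      rw [← hmean i]
      refine hasSubgaussianMGF_of_mem_Icc (hf.comp (hZ i)).aemeasurable
        (Filter.Eventually.of_forall fun ω => ?_)
      by_cases h : Z i ω ∈ A <;> simp [h]
  have hind' : iIndepFun
      (fun i ω => A.indicator (fun _ => (1 : ℝ)) (Z i ω) - H.real A) P :=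
    hind.comp (fun _ z => A.indicator (fun _ => (1 : ℝ)) z - H.real A)
      (fun _ => hf.sub_const _)
  have key := HasSubgaussianMGF.measure_sum_ge_le_of_iIndepFun hind' hsub
    (ε := n * ε) (by positivity)
  have hn0 : (n : ℝ) ≠ 0 := by positivity
  convert key using 2
  · ext ω
    simp only [Set.mem_ofPred_eq, countIn, Finset.sum_sub_distrib, Finset.sum_const,
      Finset.card_univ, Fintype.card_fin, nsmul_eq_mul]
    constructor <;> intro h <;> linarith
  · simp
    field_simp

/-- Hoeffding's lower tail bound for the number of sample points in a measurable set. -/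
lemma measureReal_countIn_le_le {Ω α : Type*} [MeasurableSpace Ω] [MeasurableSpace α]
    {P : Measure Ω} [IsProbabilityMeasure P] {H : Measure α} [IsProbabilityMeasure H] {n : ℕ}
    {Z : Fin n → Ω → α} (hZ : ∀ i, Measurable (Z i)) (hlaw : ∀ i, P.map (Z i) = H)
    (hind : iIndepFun Z P) {A : Set α} (hA : MeasurableSet A) {ε : ℝ} (hε : 0 ≤ ε) :
    P.real {ω | countIn A (fun i => Z i ω) ≤ (n : ℝ) * (H.real A - ε)}
      ≤ Real.exp (-2 * n * ε ^ 2) := by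
  refine le_trans (measureReal_mono fun ω hω => ?_)
    (measureReal_le_countIn_le hZ hlaw hind hA.compl hε)
  have h := countIn_add_countIn_compl A fun i => Z i ω
  simp only [Set.mem_ofPred_eq, probReal_compl_eq_one_sub hA] at hω ⊢
  linarith

lemma exists_measureReal_Iic_eq {μ : Measure ℝ} [IsProbabilityMeasure μ]
    (hc : Continuous (cdf μ)) {p : ℝ} (hp : p ∈ Set.Ioo (0 : ℝ) 1) :
    ∃ a, μ.real (Set.Iic a) = p := by
  obtain ⟨a, ha⟩ := mem_range_of_exists_le_of_exists_ge hc
    (((tendsto_cdf_atBot μ).eventually (gt_mem_nhds hp.1)).exists.imp fun _ => le_of_lt)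
    (((tendsto_cdf_atTop μ).eventually (lt_mem_nhds hp.2)).exists.imp fun _ => le_of_lt)
  exact ⟨a, by rw [← cdf_eq_real, ha]⟩

lemma sampleRank_eq_countIn {n : ℕ} (a : Fin n → ℝ) (i : Fin n) :
    (sampleRank a i : ℝ) = countIn (Set.Iic (a i)) a := by
  classical
  simp only [sampleRank, countIn, Set.indicator_apply, Set.mem_Iic]
  rw [Finset.sum_boole]

lemma countIn_mono {α : Type*} {n : ℕ} {A B : Set α} (h : A ⊆ B) (z : Fin n → α) :
    countIn A z ≤ countIn B z :=
  Finset.sum_le_sum fun _ _ =>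
    Set.indicator_le_indicator_of_subset h (fun _ => zero_le_one) _

/-- A point beyond `a` has rank at least the number of points up to `a`, hence above `n * u`. Ties
do no harm. -/
lemma le_of_sampleRank_div_le {n : ℕ} (hn : 0 < n) {x : Fin n → ℝ} {u a : ℝ}
    (h : n * u < countIn (Set.Iic a) x) {i : Fin n} (hi : (sampleRank x i : ℝ) / n ≤ u) :
    x i ≤ a := by
  by_contra! hlt
  rw [div_le_iff₀' (by positivity), sampleRank_eq_countIn] at hi
  exact absurd (countIn_mono (Set.Iic_subset_Iic.2 hlt.le) x) (by linarith)

lemma sampleRank_div_le_of_le {n : ℕ} (hn : 0 < n) {x : Fin n → ℝ} {u a : ℝ}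
    (h : countIn (Set.Iic a) x ≤ n * u) {i : Fin n} (hi : x i ≤ a) :
    (sampleRank x i : ℝ) / n ≤ u := by
  rw [div_le_iff₀' (by positivity), sampleRank_eq_countIn]
  exact (countIn_mono (Set.Iic_subset_Iic.2 hi) x).trans h

lemma empiricalCopula_nonneg {n : ℕ} (x y : Fin n → ℝ) (u v : ℝ) :
    0 ≤ empiricalCopula x y u v := by
  rw [empiricalCopula]
  exact mul_nonneg (by positivity) (Finset.sum_nonneg fun i _ => by split_ifs <;> norm_num)

lemma mul_empiricalCopula {n : ℕ} (hn : 0 < n) (x y : Fin n → ℝ) (u v : ℝ) :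
    n * empiricalCopula x y u v = countIn
      {i : Fin n | (sampleRank x i : ℝ) / n ≤ u ∧ (sampleRank y i : ℝ) / n ≤ v} id := by
  classical
  have hn0 : (n : ℝ) ≠ 0 := by positivity
  rw [empiricalCopula, ← mul_assoc, mul_one_div_cancel hn0, one_mul]
  simp [countIn, Set.indicator_apply]

lemma empiricalCopula_le_one {n : ℕ} (hn : 0 < n) (x y : Fin n → ℝ) (u v : ℝ) :
    empiricalCopula x y u v ≤ 1 := by
  have hn0 : (0 : ℝ) < n := by positivity
  have h := countIn_mono (Set.subset_univ
    {i : Fin n | (sampleRank x i : ℝ) / n ≤ u ∧ (sampleRank y i : ℝ) / n ≤ v}) id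
  rw [← mul_empiricalCopula hn] at h
  have h' : countIn Set.univ (id : Fin n → Fin n) = n := by simp [countIn]
  nlinarith

lemma mul_empiricalCopula_le {n : ℕ} (hn : 0 < n) {x y : Fin n → ℝ} {u v a b : ℝ}
    (ha : n * u < countIn (Set.Iic a) x) (hb : n * v < countIn (Set.Iic b) y) :
    n * empiricalCopula x y u v ≤ countIn (Set.Iic a ×ˢ Set.Iic b) (fun i => (x i, y i)) := by
  rw [mul_empiricalCopula hn]
  exact countIn_mono (B := (fun i => (x i, y i)) ⁻¹' (Set.Iic a ×ˢ Set.Iic b)) (fun i hi =>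
    ⟨le_of_sampleRank_div_le hn ha hi.1, le_of_sampleRank_div_le hn hb hi.2⟩) id

lemma le_mul_empiricalCopula {n : ℕ} (hn : 0 < n) {x y : Fin n → ℝ} {u v a b : ℝ}
    (ha : countIn (Set.Iic a) x ≤ n * u) (hb : countIn (Set.Iic b) y ≤ n * v) :
    countIn (Set.Iic a ×ˢ Set.Iic b) (fun i => (x i, y i)) ≤ n * empiricalCopula x y u v := by
  rw [mul_empiricalCopula hn]
  refine countIn_mono (A := (fun i => (x i, y i)) ⁻¹' (Set.Iic a ×ˢ Set.Iic b)) (fun i hi => ?_) id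
  exact ⟨sampleRank_div_le_of_le hn ha hi.1, sampleRank_div_le_of_le hn hb hi.2⟩

lemma measureReal_union₃_le {Ω : Type*} [MeasurableSpace Ω] {P : Measure Ω} [IsFiniteMeasure P]
    {S E₁ E₂ E₃ : Set Ω} {r : ℝ} (hS : S ⊆ E₁ ∪ E₂ ∪ E₃) (h₁ : P.real E₁ ≤ r)
    (h₂ : P.real E₂ ≤ r) (h₃ : P.real E₃ ≤ r) : P.real S ≤ 3 * r := by
  have h := measureReal_mono (μ := P) hS
  have h' := measureReal_union_le (μ := P) (E₁ ∪ E₂) E₃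
  have h'' := measureReal_union_le (μ := P) E₁ E₂
  linarith

section Sample

variable {Ω : Type*} [MeasurableSpace Ω] {P : Measure Ω} {H : Measure (ℝ × ℝ)} {n : ℕ}
  {X Y : Fin n → Ω → ℝ}

lemma IsIIDSample.measurable_pair (h : IsIIDSample P H X Y) (i : Fin n) :
    Measurable fun ω => (X i ω, Y i ω) :=
  (h.measurable_fst i).prodMk (h.measurable_snd i)

lemma IsIIDSample.map_fst (h : IsIIDSample P H X Y) (i : Fin n) : P.map (X i) = H.fst := by
  rw [← h.law i, Measure.fst_map_prodMk (h.measurable_snd i)]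

lemma IsIIDSample.map_snd (h : IsIIDSample P H X Y) (i : Fin n) : P.map (Y i) = H.snd := by
  rw [← h.law i, Measure.snd_map_prodMk (h.measurable_fst i)]

lemma IsIIDSample.iIndepFun_fst (h : IsIIDSample P H X Y) : iIndepFun X P :=
  h.indep.comp (fun _ => Prod.fst) fun _ => _root_.measurable_fst

lemma IsIIDSample.iIndepFun_snd (h : IsIIDSample P H X Y) : iIndepFun Y P :=
  h.indep.comp (fun _ => Prod.snd) fun _ => _root_.measurable_snd

lemma NullHypothesis.measureReal_prod [IsProbabilityMeasure H] (h : NullHypothesis H)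
    (A B : Set ℝ) : H.real (A ×ˢ B) = H.fst.real A * H.snd.real B := by
  conv_lhs => rw [h]
  exact measureReal_prod_prod A B

variable [IsProbabilityMeasure P] [IsProbabilityMeasure H]

/-- Upper tail bound for the empirical copula under independence. -/
lemma measureReal_lt_empiricalCopula_le (hn : 0 < n) (h : IsIIDSample P H X Y)
    (hc : HasContinuousMarginals H) (h0 : NullHypothesis H) {u v δ : ℝ} (hδ : 0 ≤ δ)
    (hu0 : 0 < u) (hv0 : 0 < v) (hu : u + δ < 1) (hv : v + δ < 1) :
    P.real {ω | u * v + 4 * δ < empiricalCopula (fun i => X i ω) (fun i => Y i ω) u v}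
      ≤ 3 * Real.exp (-2 * n * δ ^ 2) := by
  have hn0 : (0 : ℝ) < n := by positivity
  -- With level `u + δ`, the count up to `a` can fall to `n * u` only by a deviation of `δ` from its
  -- mean.
  obtain ⟨a, ha⟩ := exists_measureReal_Iic_eq hc.1 (p := u + δ) ⟨by linarith, hu⟩
  obtain ⟨b, hb⟩ := exists_measureReal_Iic_eq hc.2 (p := v + δ) ⟨by linarith, hv⟩
  refine measureReal_union₃_le ?_
    (measureReal_countIn_le_le h.measurable_fst h.map_fst h.iIndepFun_fst
      (measurableSet_Iic (a := a)) hδ)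
    (measureReal_countIn_le_le h.measurable_snd h.map_snd h.iIndepFun_snd
      (measurableSet_Iic (a := b)) hδ)
    (measureReal_le_countIn_le h.measurable_pair h.law h.indep
      ((measurableSet_Iic (a := a)).prod (measurableSet_Iic (a := b))) hδ)
  intro ω hω
  by_contra hcon
  simp only [Set.mem_union, Set.mem_ofPred_eq, not_or, not_le, h0.measureReal_prod, ha, hb,
    add_sub_cancel_right] at hcon hω
  have hle := mul_empiricalCopula_le hn hcon.1.1 hcon.1.2
  have hlt := lt_of_mul_lt_mul_left (hle.trans_lt hcon.2) hn0.le
  -- `(u + δ) * (v + δ) + δ ≤ u * v + 4 * δ`, because `u + δ < 1` and `v < 1`.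
  nlinarith

/-- Lower tail bound for the empirical copula under independence. -/
lemma measureReal_empiricalCopula_le_le (hn : 0 < n) (h : IsIIDSample P H X Y)
    (hc : HasContinuousMarginals H) (h0 : NullHypothesis H) {u v δ : ℝ} (hδ : 0 < δ)
    (hu1 : u < 1) (hv1 : v < 1) (hu : 0 < u - δ) (hv : 0 < v - δ) :
    P.real {ω | empiricalCopula (fun i => X i ω) (fun i => Y i ω) u v ≤ u * v - 4 * δ}
      ≤ 3 * Real.exp (-2 * n * δ ^ 2) := by
  have hn0 : (0 : ℝ) < n := by positivity
  obtain ⟨a, ha⟩ := exists_measureReal_Iic_eq hc.1 (p := u - δ) ⟨hu, by linarith⟩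
  obtain ⟨b, hb⟩ := exists_measureReal_Iic_eq hc.2 (p := v - δ) ⟨hv, by linarith⟩
  refine measureReal_union₃_le ?_
    (measureReal_le_countIn_le h.measurable_fst h.map_fst h.iIndepFun_fst
      (measurableSet_Iic (a := a)) hδ.le)
    (measureReal_le_countIn_le h.measurable_snd h.map_snd h.iIndepFun_snd
      (measurableSet_Iic (a := b)) hδ.le)
    (measureReal_countIn_le_le h.measurable_pair h.law h.indep
      ((measurableSet_Iic (a := a)).prod (measurableSet_Iic (a := b))) hδ.le)
  intro ω hω
  by_contra hcon
  simp only [Set.mem_union, Set.mem_ofPred_eq, not_or, not_le, h0.measureReal_prod, ha, hb,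
    sub_add_cancel] at hcon hω
  have hle := le_mul_empiricalCopula hn hcon.1.1.le hcon.1.2.le
  have hlt := lt_of_mul_lt_mul_left (hcon.2.trans_le hle) hn0.le
  nlinarith

end Sample

lemma hasSubgaussianMGF_id_gaussianReal :
    HasSubgaussianMGF id 1 (gaussianReal 0 1) where
  integrable_exp_mul t := by simpa using integrable_exp_mul_gaussianReal t
  mgf_le t := by simp [mgf_id_gaussianReal]

lemma stdNormalCDF_le_exp {t : ℝ} (ht : t ≤ 0) : stdNormalCDF t ≤ Real.exp (-t ^ 2 / 2) := by
  have h := hasSubgaussianMGF_id_gaussianReal.neg.measure_ge_le (ε := -t) (by linarith)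
  rw [stdNormalCDF, cdf_eq_real]
  convert h using 2
  · ext y
    simp
  · simp

lemma one_sub_stdNormalCDF_le_exp {t : ℝ} (ht : 0 ≤ t) :
    1 - stdNormalCDF t ≤ Real.exp (-t ^ 2 / 2) := by
  have h := hasSubgaussianMGF_id_gaussianReal.measure_ge_le ht
  rw [stdNormalCDF, cdf_eq_real, ← probReal_compl_eq_one_sub measurableSet_Iic]
  refine (measureReal_mono fun y hy => ?_).trans (h.trans_eq (by simp))
  exact (Set.mem_Ioi.1 (Set.compl_Iic (a := t) ▸ hy)).le

/-- Subadditivity is enough, so `S` need not be shown measurable. -/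
lemma one_sub_measureReal_le {Ω : Type*} [MeasurableSpace Ω] (P : Measure Ω)
    [IsProbabilityMeasure P] (S : Set Ω) : 1 - P.real S ≤ P.real Sᶜ := by
  have h := measureReal_union_le (μ := P) S Sᶜ
  rw [Set.union_compl_self, probReal_univ] at h
  linarith

/-- `x` is in the large deviation range `n x⁴ ≥ 1`, where the Gaussian and the empirical copula
tails are both exponentially small. -/
lemma one_le_sqrt_mul_sq {x : ℝ} (hx : x ≠ 0) {n : ℕ} (h : 1 / x ^ 4 ≤ n) :
    1 ≤ Real.sqrt n * x ^ 2 := by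
  have hx4 : 0 < x ^ 4 := by positivity
  rw [div_le_iff₀ hx4] at h
  have h1 : Real.sqrt n * x ^ 2 = Real.sqrt (n * x ^ 4) := by
    rw [Real.sqrt_mul (Nat.cast_nonneg n), show x ^ 4 = (x ^ 2) ^ 2 by ring,
      Real.sqrt_sq (sq_nonneg x)]
  rw [h1]
  exact Real.one_le_sqrt.2 h

theorem mainTheorem2 (u v : ℝ) (hu : u ∈ Set.Ioo (0 : ℝ) 1) (hv : v ∈ Set.Ioo (0 : ℝ) 1)
    (d : ℝ) (hd : 0 < d) :
    ∃ A₁ A₂ : ℝ, 0 < A₁ ∧ 0 < A₂ ∧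
      ∀ x : ℝ, x ≠ 0 → ∀ n : ℕ, 1 / x ^ 4 ≤ (n : ℝ) →
        ∀ (Ω : Type*) [MeasurableSpace Ω] (P : Measure Ω) [IsProbabilityMeasure P]
          (H : Measure (ℝ × ℝ)) [IsProbabilityMeasure H] (X Y : Fin n → Ω → ℝ),
          IsIIDSample P H X Y → HasContinuousMarginals H → NullHypothesis H →
            |P.real {ω | empiricalCopula (fun i => X i ω) (fun i => Y i ω) u v - u * v ≤ x}
                - stdNormalCDF (Real.sqrt ((n : ℝ) / d) * x)|
              ≤ A₁ * Real.sqrt (n : ℝ) * x ^ 2 * Real.exp (-A₂ * (n : ℝ) * x ^ 2) := by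
  obtain ⟨hu0, hu1⟩ := hu
  obtain ⟨hv0, hv1⟩ := hv
  -- For `δ = c * |x|` with `|x| ≤ 1`, the levels `u ± δ` and `v ± δ` stay in `(0, 1)`; the factor
  -- `1/4` gives `4 * δ ≤ |x|`.
  obtain ⟨c, hc0, hc⟩ : ∃ c : ℝ, 0 < c ∧ c < min (min u (1 - u)) (min v (1 - v)) / 4 :=
    exists_between (by
      have : 0 < min (min u (1 - u)) (min v (1 - v)) := by simp [*]
      positivity)
  rw [lt_div_iff₀ (by norm_num)] at hc
  simp only [lt_min_iff] at hc
  obtain ⟨⟨hcu, hcu'⟩, hcv, hcv'⟩ := hc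
  -- `3` counts the Hoeffding events; the minimum is over the Hoeffding and Gaussian exponents.
  refine ⟨3, min (2 * c ^ 2) (1 / (2 * d)), by norm_num, by positivity, ?_⟩
  intro x hx n hn Ω _ P _ H _ X Y h hcont h0
  set A₂ := min (2 * c ^ 2) (1 / (2 * d)) with hA₂
  have hn0 : (0 : ℝ) < n := lt_of_lt_of_le (by positivity) hn
  have hnpos : 0 < n := by exact_mod_cast hn0
  set E := Real.exp (-A₂ * n * x ^ 2) with hE
  have hEpos : 0 < E := Real.exp_pos _
  have hRHS : 3 * E ≤ 3 * Real.sqrt n * x ^ 2 * E := by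
    have := one_le_sqrt_mul_sq hx hn
    nlinarith
  refine le_trans ?_ hRHS
  have hnx : 0 < n * x ^ 2 := by positivity
  have hcop : Real.exp (-2 * n * (c * |x|) ^ 2) ≤ E := by
    refine Real.exp_le_exp.2 ?_
    rw [mul_pow, sq_abs]
    nlinarith [min_le_left (2 * c ^ 2) (1 / (2 * d))]
  have hgauss : Real.exp (-(Real.sqrt (n / d) * x) ^ 2 / 2) ≤ E := by
    refine Real.exp_le_exp.2 ?_
    rw [mul_pow, Real.sq_sqrt (by positivity)]
    have h1 : -(n / d * x ^ 2) / 2 = -(1 / (2 * d)) * (n * x ^ 2) := by field_simp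
    rw [h1]
    nlinarith [min_le_right (2 * c ^ 2) (1 / (2 * d))]
  have hΦ0 : 0 ≤ stdNormalCDF (Real.sqrt (n / d) * x) := cdf_nonneg _ _
  have hΦ1 : stdNormalCDF (Real.sqrt (n / d) * x) ≤ 1 := cdf_le_one _ _
  set S := {ω | empiricalCopula (fun i => X i ω) (fun i => Y i ω) u v - u * v ≤ x} with hS
  have hP0 : 0 ≤ P.real S := measureReal_nonneg
  have hP1 : P.real S ≤ 1 := measureReal_le_one
  have huv0 : 0 < u * v := mul_pos hu0 hv0
  have huv1 : u * v < 1 := by nlinarith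
  have habs : 0 < |x| := abs_pos.2 hx
  have hδ : 0 < c * |x| := mul_pos hc0 habs
  have hδ4 : 4 * (c * |x|) ≤ |x| := by nlinarith
  have hδc : |x| ≤ 1 → c * |x| ≤ c := fun h1 => mul_le_of_le_one_right hc0.le h1
  rcases lt_or_gt_of_ne hx with hneg | hpos
  · have hΦ := (stdNormalCDF_le_exp
      (mul_nonpos_of_nonneg_of_nonpos (Real.sqrt_nonneg (n / d)) hneg.le)).trans hgauss
    have hP : P.real S ≤ 3 * E := by
      rw [abs_of_neg hneg] at *
      by_cases h1 : -x ≤ 1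
      · have hcx := hδc h1
        refine le_trans (measureReal_mono fun ω hω => ?_)
          ((measureReal_empiricalCopula_le_le hnpos h hcont h0 hδ hu1 hv1
            (by linarith) (by linarith)).trans (by linarith))
        simp only [hS, Set.mem_ofPred_eq] at hω ⊢
        linarith
      -- Beyond `|x| = 1` the deviation is impossible, as `C_n` and `u * v` lie in `[0, 1]`.
      · have : S = ∅ := Set.eq_empty_of_forall_notMem fun ω hω => by
          have := empiricalCopula_nonneg (fun i => X i ω) (fun i => Y i ω) u v
          simp only [hS, Set.mem_ofPred_eq] at hω
          linarith
        rw [this, measureReal_empty]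
        positivity
    exact abs_sub_le_iff.2 ⟨by linarith, by linarith⟩
  · have hΦ := (one_sub_stdNormalCDF_le_exp
      (mul_nonneg (Real.sqrt_nonneg (n / d)) hpos.le)).trans hgauss
    have hP : P.real Sᶜ ≤ 3 * E := by
      rw [abs_of_pos hpos] at *
      by_cases h1 : x ≤ 1
      · have hcx := hδc h1
        refine le_trans (measureReal_mono fun ω hω => ?_)
          ((measureReal_lt_empiricalCopula_le hnpos h hcont h0 hδ.le hu0 hv0
            (by linarith) (by linarith)).trans (by linarith))
        simp only [hS, Set.mem_compl_iff, Set.mem_ofPred_eq, not_le] at hω ⊢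
        linarith
      · have : Sᶜ = ∅ := Set.eq_empty_of_forall_notMem fun ω hω => by
          have := empiricalCopula_le_one hnpos (fun i => X i ω) (fun i => Y i ω) u v
          simp only [hS, Set.mem_compl_iff, Set.mem_ofPred_eq, not_le] at hω
          linarith
        rw [this, measureReal_empty]
        positivity
    have hcompl := one_sub_measureReal_le P S
    exact abs_sub_le_iff.2 ⟨by linarith, by linarith⟩
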